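/- For integers $m\ge 3$, $q\ge 1$ and a word $\boldsymbol w=(w_1,\dots,w_m)\in\{2,\dots,q+1\}^m$, let $G_{\boldsymbol w}$ be the following simple graph on $N=N_{m,q}=4m+q-1$ vertices. Its vertices are a root $\rho$, anchors $a_1,\dots,a_q$, and the vertices of four pairwise disjoint paths $u_1-\cdots-u_m$, $v_1-\cdots-v_m$, $u'_1-\cdots-u'_{m-1}$, $v'_1-\cdots-v'_{m-1}$. Its edges are the edges of the four paths; the edges $\rho a_t$ for $1\le t\le q$; for each $1\le i\le m$, the edges joining both $u_i$ and $v_i$ to $a_1,\dots,a_{h_i}$, where $h_i=w_i-\delta_i^{(m)}$; and, for each $1\le i\le m-1$, the edges joining both $u'_i$ and $v'_i$ to $a_1,\dots,a_{h'_i}$, where $h'_i=w_i-\delta_i^{(m-1)}$. Here $\delta_i^{(r)}=\mathbf 1_{i>1}+\mathbf 1_{i<r}$ is the degree of the $i$-th vertex of a path on $r$ vertices. Write $\tau(G)$ for the number of spanning trees of a graph $G$. Proposition. For every $\eta>0$ there is an $s_0$, depending only on $\eta$, such that for all integers $m\ge 3$ and $q\ge 1$ with $m+q\ge s_0$, $$\bigl|\{\tau(G_{\boldsymbol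 w}) : \boldsymbol w\in\{2,\dots,q+1\}^m\}\bigr|\;\ge\;\frac{q^m}{(q+1)^{2\eta m}\,N^{\eta N}},\qquad N=4m+q-1 .$$ -/

import Mathlib

namespace TreeSpectrum

/-- The number `τ(G)` of spanning trees of a graph `G`: the number of trees on the whole
vertex set all of whose edges are edges of `G`. -/
noncomputable def spanningTreeCount {V : Type*} (G : SimpleGraph V) : ℕ :=
  Nat.card {T : SimpleGraph V // T ≤ G ∧ T.IsTree}

/-- The vertices of `G_w`: the root `ρ`, the anchors `a_1, …, a_q`, the vertices of two twin
paths on `m` vertices, and the vertices of two twin paths on `m - 1` vertices. The `Bool` tells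
the two twins of a pair apart (`false` for `u`, `true` for `v`). All indices are shifted to start
at `0`, so `anchor t` is `a_{t+1}`, `long false i` is `u_{i+1}`, `short true i` is `v'_{i+1}`. -/
inductive Vertex (m q : ℕ) : Type
  | root : Vertex m q
  | anchor (t : Fin q) : Vertex m q
  | long (c : Bool) (i : Fin m) : Vertex m q
  | short (c : Bool) (i : Fin (m - 1)) : Vertex m q
  deriving DecidableEq, Fintype

/-- The degree of the `i`-th vertex (counted from `0`) in the path on `r` vertices. -/
def pathDegree (r : ℕ) (i : Fin r) : ℕ :=
  (if 0 < i.val then 1 else 0) + (if i.val + 1 < r then 1 else 0)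

/-- `h_i = w_i - δ_i^{(m)}`, the number of anchors joined to the `i`-th vertex of each path on
`m` vertices. The subtraction does not truncate for words with letters at least `2`. -/
def longAnchors {m : ℕ} (w : Fin m → ℕ) (i : Fin m) : ℕ :=
  w i - pathDegree m i

/-- `h'_i = w_i - δ_i^{(m-1)}`, the number of anchors joined to the `i`-th vertex of each path
on `m - 1` vertices. -/
def shortAnchors {m : ℕ} (w : Fin m → ℕ) (i : Fin (m - 1)) : ℕ :=
  w (Fin.castLE (Nat.sub_le m 1) i) - pathDegree (m - 1) i

/-- The edges of `G_w`, each listed in one direction: the anchor star, the four paths, and the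
edges from the path vertices to initial segments of the anchors. -/
def Link {m q : ℕ} (w : Fin m → ℕ) : Vertex m q → Vertex m q → Prop
  | .root, .anchor _ => True
  | .long c i, .long d j => c = d ∧ i.val + 1 = j.val
  | .short c i, .short d j => c = d ∧ i.val + 1 = j.val
  | .long _ i, .anchor t => t.val < longAnchors w i
  | .short _ i, .anchor t => t.val < shortAnchors w i
  | _, _ => False

/-- The simple graph `G_w = G_{m,q,w}`. -/
def wordGraph (m q : ℕ) (w : Fin m → ℕ) : SimpleGraph (Vertex m q) :=
  SimpleGraph.fromRel (Link w)

/-- The set of words `{2, …, q+1}^m`. -/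
def words (m q : ℕ) : Finset (Fin m → ℕ) :=
  Fintype.piFinset fun _ => Finset.Icc 2 (q + 1)

/-- The number `N = 4m + q - 1` of vertices of `G_w` (for `m ≥ 1`). -/
def vertexCount (m q : ℕ) : ℕ := 4 * m + q - 1

end TreeSpectrum

/-! The anchor counts `h_i` and `h'_i` are chosen so that every path vertex has degree exactly its
letter. In the Laplacian reduced at the root, each path therefore contributes the tridiagonal block
with diagonal `w` and off-diagonal entries `-1`, whose determinant is the continuant `K_m`, or
`K_{m-1}` on the shorter paths. Twin paths see the same anchors and are not joined to each other, so
subtracting the rows of one from those of the other splits off the block determinant. By the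
matrix-tree theorem both `K_m` and `K_{m-1}` divide `τ(G_w)`.

For letters at least 2 the pair `(K_m, K_{m-1})` determines the word (`continuant_pair_injective`).
Hence at most `d(n)^2` words give `τ = n` (`card_fiber_le`). Since `0 < τ ≤ N^N`, the bound `d(n) ≤
C n^ε` shows that every fiber has size at most `N^(ηN)` once `m + q` is large, and counting the
`q^m` words by fibers finishes the proof. -/

namespace TreeSpectrum

/-! ### Spanning trees as parent maps, and the matrix-tree theorem -/

section MatrixTree

variable {V : Type*}

/-- `a` is the parent of `b` under the parent map `f`, defined away from the root `r`. -/
def ParentRel {r : V} (f : {v : V // v ≠ r} → V) (a b : V) : Prop :=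
  ∃ h : b ≠ r, a = f ⟨b, h⟩

/-- The graph joining every vertex to its parent. -/
def parentGraph {r : V} (f : {v : V // v ≠ r} → V) : SimpleGraph V :=
  SimpleGraph.fromRel (ParentRel f)

theorem parentRel_root_acc {r : V} (f : {v : V // v ≠ r} → V) : Acc (ParentRel f) r :=
  Acc.intro _ fun _ ⟨h, _⟩ => absurd rfl h

theorem parentRel_acc_iff {r : V} (f : {v : V // v ≠ r} → V) (v : {v : V // v ≠ r}) :
    Acc (ParentRel f) v ↔ Acc (ParentRel f) (f v) := by
  refine ⟨fun h => h.inv ⟨v.2, rfl⟩, fun h => Acc.intro _ ?_⟩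
  rintro a ⟨_, rfl⟩
  exact h

/-- The parent maps along edges of `G` all of whose orbits reach the root. -/
def RootedMap (G : SimpleGraph V) (r : V) : Type _ :=
  {f : {v : V // v ≠ r} → V // (∀ v : {v : V // v ≠ r}, G.Adj v (f v)) ∧ WellFounded (ParentRel f)}

theorem parentGraph_le {G : SimpleGraph V} {r : V} {f : {v : V // v ≠ r} → V}
    (hf : ∀ v : {v : V // v ≠ r}, G.Adj v (f v)) : parentGraph f ≤ G := by
  intro a b h
  rw [parentGraph, SimpleGraph.fromRel_adj] at h
  obtain ⟨_, ⟨h, rfl⟩ | ⟨h, rfl⟩⟩ := h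
  · exact (hf ⟨b, h⟩).symm
  · exact hf ⟨a, h⟩

theorem parentRel_irrefl {r : V} {f : {v : V // v ≠ r} → V} (hf : WellFounded (ParentRel f))
    (a : V) : ¬ ParentRel f a a := fun h => hf.irrefl.irrefl a h

theorem parentGraph_adj {r : V} {f : {v : V // v ≠ r} → V} (hf : WellFounded (ParentRel f))
    (v : {v : V // v ≠ r}) : (parentGraph f).Adj v (f v) := by
  rw [parentGraph, SimpleGraph.fromRel_adj]
  refine ⟨fun h => parentRel_irrefl hf v ⟨v.2, h⟩, Or.inr ⟨v.2, rfl⟩⟩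

theorem parentGraph_connected {r : V} {f : {v : V // v ≠ r} → V}
    (hf : WellFounded (ParentRel f)) : (parentGraph f).Connected := by
  have key : ∀ v, (parentGraph f).Reachable v r := by
    intro v
    induction v using hf.induction with
    | _ v ih =>
      by_cases h : v = r
      · rw [h]
      · exact (parentGraph_adj hf ⟨v, h⟩).reachable.trans (ih _ ⟨h, rfl⟩)
  have : Nonempty V := ⟨r⟩
  exact ⟨fun a b => (key a).trans (key b).symm⟩

/-- Every edge has the form `{v, f v}`, so this connected graph has at most `|V| - 1` edges. -/
theorem parentGraph_isTree [Finite V] {r : V} {f : {v : V // v ≠ r} → V}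
    (hf : WellFounded (ParentRel f)) : (parentGraph f).IsTree := by
  classical
  have := Fintype.ofFinite V
  have hc := parentGraph_connected hf
  refine SimpleGraph.isTree_iff_connected_and_card.2 ⟨hc, le_antisymm ?_
    hc.card_vert_le_card_edgeSet_add_one⟩
  have hsub : (parentGraph f).edgeSet ⊆ Set.range fun v : {v : V // v ≠ r} => s(v.1, f v) := by
    intro e
    induction e with
    | _ a b =>
      intro h
      rw [SimpleGraph.mem_edgeSet, parentGraph, SimpleGraph.fromRel_adj] at h
      obtain ⟨_, ⟨h, rfl⟩ | ⟨h, rfl⟩⟩ := h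
      · exact ⟨⟨b, h⟩, Sym2.eq_swap⟩
      · exact ⟨⟨a, h⟩, rfl⟩
  have h1 : Nat.card (parentGraph f).edgeSet ≤ Nat.card {v : V // v ≠ r} :=
    (Nat.card_mono (Set.toFinite _) hsub).trans (Finite.card_range_le _)
  have h2 : Nat.card {v : V // v ≠ r} = Nat.card V - 1 := by
    simp [Nat.card_eq_fintype_card, Fintype.card_subtype_compl]
  have : 0 < Nat.card V := Nat.card_pos_iff.2 ⟨⟨r⟩, inferInstance⟩
  omega

theorem parentGraph_injective {r : V} {f g : {v : V // v ≠ r} → V}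
    (hg : WellFounded (ParentRel g)) (h : parentGraph f = parentGraph g) : f = g := by
  have key : ∀ v : V, ∀ hv : v ≠ r, f ⟨v, hv⟩ = g ⟨v, hv⟩ := by
    intro v
    induction v using hg.induction with
    | _ v ih =>
      intro hv
      have hadj := parentGraph_adj hg ⟨v, hv⟩
      rw [← h, parentGraph, SimpleGraph.fromRel_adj] at hadj
      obtain ⟨_, ⟨h', e⟩ | ⟨_, e⟩⟩ := hadj
      -- If the common edge came from `f (g v) = v`, induction would give `g (g v) = v`, a 2-cycle
      -- of `g`.
      · rw [ih _ ⟨hv, rfl⟩ h'] at e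
        exact absurd (⟨hv, rfl⟩ : ParentRel g (g ⟨v, hv⟩) v)
          (hg.asymmetric (a := v) (b := g ⟨v, hv⟩) ⟨h', e⟩)
      · exact e.symm
  funext v
  exact key v.1 v.2

/-- The parent of `v` is the next vertex on a shortest path to `r` in `T`, so distance to `r` proves
well-foundedness. The parent graph is a connected subgraph of `T`, hence all of `T` because trees
are minimal connected graphs. -/
theorem exists_parentGraph_eq {G T : SimpleGraph V} (hT : T ≤ G) (ht : T.IsTree)
    (r : V) : ∃ f : {v : V // v ≠ r} → V,
      ((∀ v : {v : V // v ≠ r}, G.Adj v (f v)) ∧ WellFounded (ParentRel f)) ∧ parentGraph f = T := by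
  have hex : ∀ v : {v : V // v ≠ r}, ∃ u, T.Adj v u ∧ T.dist u r < T.dist v r := by
    intro v
    obtain ⟨p, hp⟩ := ht.connected.exists_walk_length_eq_dist v.1 r
    have hnil : ¬ p.Nil := fun h => v.2 h.eq
    refine ⟨p.snd, p.adj_snd hnil, ?_⟩
    have h1 := SimpleGraph.dist_le p.tail
    have h2 := SimpleGraph.Walk.length_tail_add_one hnil
    omega
  choose f hadj hdist using hex
  have hwf : WellFounded (ParentRel f) := by
    refine Subrelation.wf (r := InvImage (· < ·) fun v => T.dist v r) ?_
      (InvImage.wf _ Nat.lt_wfRel.wf)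
    rintro a b ⟨hb, rfl⟩
    exact hdist ⟨b, hb⟩
  refine ⟨f, ⟨fun v => hT (hadj v), hwf⟩, ?_⟩
  have hle := parentGraph_le hadj
  exact le_antisymm hle
    ((SimpleGraph.isTree_iff_minimal_connected.1 ht).2 (parentGraph_connected hwf) hle)

theorem spanningTreeCount_eq_card_rootedMap [Finite V] (G : SimpleGraph V) (r : V) :
    spanningTreeCount G = Nat.card (RootedMap G r) := by
  symm
  refine Nat.card_congr (Equiv.ofBijective
    (fun f => ⟨parentGraph f.1, parentGraph_le f.2.1, parentGraph_isTree f.2.2⟩) ⟨?_, ?_⟩)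
  · intro f g h
    exact Subtype.ext (parentGraph_injective g.2.2 (congrArg Subtype.val h))
  · rintro ⟨T, hT, ht⟩
    obtain ⟨f, hf, rfl⟩ := exists_parentGraph_eq hT ht r
    exact ⟨⟨f, hf⟩, rfl⟩

theorem spanningTreeCount_le [Finite V] [Nonempty V] (G : SimpleGraph V) :
    spanningTreeCount G ≤ Nat.card V ^ Nat.card V := by
  classical
  have := Fintype.ofFinite V
  let r : V := Classical.arbitrary V
  rw [spanningTreeCount_eq_card_rootedMap G r]
  have h1 : Nat.card (RootedMap G r) ≤ Nat.card ({v : V // v ≠ r} → V) :=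
    Nat.card_le_card_of_injective (fun f => f.1) Subtype.val_injective
  refine h1.trans ?_
  rw [Nat.card_fun]
  exact Nat.pow_le_pow_right Nat.card_pos
    (Nat.card_le_card_of_injective _ Subtype.val_injective)

theorem spanningTreeCount_pos [Finite V] {G : SimpleGraph V} (h : G.Connected) :
    0 < spanningTreeCount G := by
  obtain ⟨T, hT, ht⟩ := h.exists_isTree_le
  exact Nat.card_pos_iff.2 ⟨⟨⟨T, hT, ht⟩⟩, inferInstance⟩

variable [Fintype V] [DecidableEq V]

/-- The matrix `I - P_f` of a parent map `f`, on the vertices other than the root. -/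
def parentMatrix {r : V} (f : {v : V // v ≠ r} → V) :
    Matrix {v : V // v ≠ r} {v : V // v ≠ r} ℤ :=
  fun i j => (if i = j then 1 else 0) - (if f i = j then 1 else 0)

/-- Ordering vertices by decreasing rank makes the matrix triangular with ones on the diagonal. -/
theorem det_parentMatrix_of_wellFounded {r : V} {f : {v : V // v ≠ r} → V}
    (hf : WellFounded (ParentRel f)) : (parentMatrix f).det = 1 := by
  classical
  have : IsWellFounded V (ParentRel f) := ⟨hf⟩
  let b : {v : V // v ≠ r} → Ordinalᵒᵈ :=
    fun v => OrderDual.toDual (IsWellFounded.rank (ParentRel f) v.1)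
  have hlt : ∀ i j : {v : V // v ≠ r}, f i = j → b i < b j := by
    intro i j h
    exact OrderDual.toDual_lt_toDual.2 (IsWellFounded.rank_lt_of_rel ⟨i.2, h.symm⟩)
  have htri : (parentMatrix f).BlockTriangular b := by
    intro i j hij
    have h1 : i ≠ j := by rintro rfl; exact lt_irrefl _ hij
    have h2 : f i ≠ j := fun h => lt_asymm hij (hlt i j h)
    simp [parentMatrix, h1, h2]
  rw [htri.det]
  refine Finset.prod_eq_one fun a _ => ?_
  have : (parentMatrix f).toSquareBlock b a = 1 := by
    ext ⟨i, hi⟩ ⟨j, hj⟩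
    have h2 : f i ≠ j := fun h => by
      have := hlt i j h
      rw [hi, hj] at this
      exact lt_irrefl _ this
    simp [Matrix.toSquareBlock_def, parentMatrix, h2, Matrix.one_apply]
  rw [this, Matrix.det_one]

/-- The indicator of the vertices whose orbit never reaches the root is a nonzero kernel vector. -/
theorem det_parentMatrix_of_not_wellFounded {r : V} {f : {v : V // v ≠ r} → V}
    (hf : ¬ WellFounded (ParentRel f)) : (parentMatrix f).det = 0 := by
  classical
  obtain ⟨v, hv⟩ : ∃ v, ¬ Acc (ParentRel f) v := by
    by_contra! h
    exact hf ⟨h⟩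
  have hvr : v ≠ r := by rintro rfl; exact hv (parentRel_root_acc f)
  refine Matrix.exists_mulVec_eq_zero_iff.1
    ⟨fun u => if Acc (ParentRel f) u.1 then 0 else 1, ?_, ?_⟩
  · intro h
    simpa [hv] using congrFun h ⟨v, hvr⟩
  · funext i
    simp only [Matrix.mulVec, dotProduct, parentMatrix, sub_mul, ite_mul, one_mul, zero_mul,
      Finset.sum_sub_distrib, Finset.sum_ite_eq, Finset.mem_univ, if_true, Pi.zero_apply]
    by_cases h : f i = r
    · have h0 : ∀ j : {v : V // v ≠ r}, ¬ f i = j := fun j hj => j.2 (hj.symm.trans h)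
      have h1 : Acc (ParentRel f) i := by
        rw [parentRel_acc_iff, h]; exact parentRel_root_acc f
      simp [h0, h1]
    · have h0 : ∀ j : {v : V // v ≠ r}, f i = j ↔ ⟨f i, h⟩ = j := fun j => by
        rw [Subtype.ext_iff]
      simp only [h0, Finset.sum_ite_eq, Finset.mem_univ, if_true, parentRel_acc_iff f i]
      simp

/-- The Laplacian of `G` with the row and the column of `r` deleted. -/
def reducedLaplacian (G : SimpleGraph V) [DecidableRel G.Adj] (r : V) :
    Matrix {v : V // v ≠ r} {v : V // v ≠ r} ℤ :=
  (G.lapMatrix ℤ).submatrix Subtype.val Subtype.val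

/-- The matrix-tree theorem. -/
theorem spanningTreeCount_eq_det (G : SimpleGraph V) [DecidableRel G.Adj] (r : V) :
    (spanningTreeCount G : ℤ) = (reducedLaplacian G r).det := by
  classical
  -- Row `i` is the sum of `e_i - e_u` over the neighbours `u` of `i`, with `e_r` read as zero.
  -- Multilinearity then expands the determinant over all parent maps.
  have hrow : reducedLaplacian G r = fun i : {v : V // v ≠ r} => ∑ u : V,
      (if G.Adj i u then 1 else 0 : ℤ) •
        fun j : {v : V // v ≠ r} => (if i = j then 1 else 0 : ℤ) - (if u = j then 1 else 0) := by
    funext i j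
    simp only [Finset.sum_apply, Pi.smul_apply, smul_eq_mul, mul_sub, Finset.sum_sub_distrib]
    rw [← Finset.sum_mul, ← SimpleGraph.degree_eq_sum_if_adj]
    simp [reducedLaplacian, SimpleGraph.lapMatrix, SimpleGraph.degMatrix, Matrix.diagonal_apply,
      SimpleGraph.adjMatrix_apply, Subtype.ext_iff]
  have hexp : (reducedLaplacian G r).det = ∑ f : {v : V // v ≠ r} → V,
      (∏ i : {v : V // v ≠ r}, (if G.Adj i (f i) then 1 else 0 : ℤ)) * (parentMatrix f).det := by
    rw [hrow]
    refine (Matrix.detRowAlternating.toMultilinearMap.map_sum _).trans ?_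
    refine Finset.sum_congr rfl fun f _ => ?_
    exact MultilinearMap.map_smul_univ _ _ _
  rw [hexp, spanningTreeCount_eq_card_rootedMap G r, RootedMap, Nat.card_eq_fintype_card,
    Fintype.card_subtype, Finset.card_filter, Nat.cast_sum]
  refine Finset.sum_congr rfl fun f _ => ?_
  by_cases h1 : ∀ v : {v : V // v ≠ r}, G.Adj v (f v)
  · by_cases h2 : WellFounded (ParentRel f)
    · simp [h1, h2, det_parentMatrix_of_wellFounded]
    · simp [h2, det_parentMatrix_of_not_wellFounded]
  · rw [if_neg fun h => h1 h.1]
    push Not at h1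
    obtain ⟨v, hv⟩ := h1
    rw [Finset.prod_eq_zero (Finset.mem_univ v) (by rw [if_neg hv]), zero_mul, Nat.cast_zero]

end MatrixTree

end TreeSpectrum

/-! ### The divisor bound -/

namespace TreeSpectrum

/-- The divisor bound: `d(n) ≤ C n ^ ε`. -/
theorem exists_card_divisors_le_rpow {ε : ℝ} (hε : 0 < ε) :
    ∃ C : ℝ, 1 ≤ C ∧ ∀ n : ℕ, n ≠ 0 → (n.divisors.card : ℝ) ≤ C * (n : ℝ) ^ ε := by
  -- Primes `p ≥ P` satisfy `p ^ ε ≥ 2`, so `a + 1 ≤ 2 ^ a` costs no constant there; each of the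
  -- fewer than `P + 1` smaller primes costs a factor `B`.
  obtain ⟨P, hP⟩ := exists_nat_ge ((2 : ℝ) ^ (1 / ε))
  -- bound for small primes
  set B : ℝ := 1 + 1 / (ε * Real.log 2) with hB
  have hl : 0 < ε * Real.log 2 := mul_pos hε (Real.log_pos one_lt_two)
  have hB1 : 1 ≤ B := by
    have : 0 < 1 / (ε * Real.log 2) := one_div_pos.2 hl
    linarith
  have hsmall : ∀ p a : ℕ, 2 ≤ p → (a + 1 : ℝ) ≤ B * ((p : ℝ) ^ a) ^ ε := by
    intro p a hp
    have hp' : (2 : ℝ) ≤ p := by exact_mod_cast hp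
    have h1 : ((2 : ℝ) ^ a) ^ ε ≤ ((p : ℝ) ^ a) ^ ε := by gcongr
    have h2 : 1 + a * (ε * Real.log 2) ≤ ((2 : ℝ) ^ a) ^ ε := by
      rw [Real.rpow_def_of_pos (by positivity), Real.log_pow]
      have := Real.add_one_le_exp (a * Real.log 2 * ε)
      linarith
    refine le_trans ?_ (mul_le_mul_of_nonneg_left (h2.trans h1) (by linarith))
    have h3 : B * (1 + a * (ε * Real.log 2)) =
        1 + a + 1 / (ε * Real.log 2) + a * (ε * Real.log 2) := by
      rw [hB]; field_simp; ring
    rw [h3]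
    have : 0 ≤ 1 / (ε * Real.log 2) := by positivity
    have : 0 ≤ a * (ε * Real.log 2) := by positivity
    linarith
  have hlarge : ∀ p a : ℕ, P ≤ p → (a + 1 : ℝ) ≤ ((p : ℝ) ^ a) ^ ε := by
    intro p a hp
    have hp' : (2 : ℝ) ^ (1 / ε) ≤ p := hP.trans (by exact_mod_cast hp)
    have h1 : (2 : ℝ) ≤ (p : ℝ) ^ ε := by
      calc (2 : ℝ) = ((2 : ℝ) ^ (1 / ε)) ^ ε := by
            rw [← Real.rpow_mul (by norm_num), one_div_mul_cancel hε.ne', Real.rpow_one]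
        _ ≤ _ := by gcongr
    have h2 : ((p : ℝ) ^ a) ^ ε = ((p : ℝ) ^ ε) ^ a := by
      rw [← Real.rpow_natCast_mul (by positivity), mul_comm,
        Real.rpow_mul_natCast (by positivity)]
    rw [h2]
    calc (a + 1 : ℝ) ≤ 2 ^ a := by exact_mod_cast Nat.lt_two_pow_self (n := a)
      _ ≤ _ := by gcongr
  refine ⟨B ^ P, one_le_pow₀ hB1, fun n hn => ?_⟩
  have hn' : (n : ℝ) ^ ε = ∏ p ∈ n.primeFactors, ((p : ℝ) ^ (n.factorization p)) ^ ε := by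
    rw [Real.finsetProd_rpow _ _ fun p _ => by positivity]
    congr 1
    conv_lhs => rw [← Nat.prod_factorization_pow_eq_self hn]
    rw [Finsupp.prod, Nat.support_factorization]
    push_cast
    rfl
  rw [Nat.card_divisors hn, hn']
  push_cast
  calc ∏ p ∈ n.primeFactors, ((n.factorization p : ℝ) + 1)
      ≤ ∏ p ∈ n.primeFactors,
          ((if p < P then B else 1) * ((p : ℝ) ^ (n.factorization p)) ^ ε) := by
        refine Finset.prod_le_prod (fun p _ => by positivity) fun p hp => ?_
        split_ifs with h
        · exact hsmall p _ (Nat.prime_of_mem_primeFactors hp).two_le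
        · rw [one_mul]; exact hlarge p _ (not_lt.1 h)
    _ = (∏ p ∈ n.primeFactors, if p < P then B else 1) *
          ∏ p ∈ n.primeFactors, ((p : ℝ) ^ (n.factorization p)) ^ ε := Finset.prod_mul_distrib
    _ ≤ _ := by
        gcongr
        rw [Finset.prod_ite, Finset.prod_const, Finset.prod_const_one, mul_one]
        refine pow_le_pow_right₀ hB1 ?_
        calc _ ≤ (Finset.range P).card := Finset.card_le_card fun p hp => by
              simpa using (Finset.mem_filter.1 hp).2
          _ = P := Finset.card_range P

end TreeSpectrum

/-! ### Continuants and tridiagonal determinants -/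

namespace TreeSpectrum

/-- The continuants `K_n = w_{n-1} K_{n-1} - K_{n-2}`. -/
def continuant (w : ℕ → ℤ) : ℕ → ℤ
  | 0 => 1
  | 1 => w 0
  | n + 2 => w (n + 1) * continuant w (n + 1) - continuant w n

/-- The tridiagonal matrix with diagonal `w` and off-diagonal entries `-1`. -/
def pathMatrix (w : ℕ → ℤ) (n : ℕ) : Matrix (Fin n) (Fin n) ℤ := fun i j =>
  (if i = j then w i else 0) - (if i.val + 1 = j.val ∨ j.val + 1 = i.val then 1 else 0)

theorem det_pathMatrix (w : ℕ → ℤ) : ∀ n, (pathMatrix w n).det = continuant w n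
  | 0 => by simp [continuant]
  | 1 => by simp [continuant, pathMatrix]
  | n + 2 => by
    have h1 := det_pathMatrix w (n + 1)
    have h0 := det_pathMatrix w n
    rw [Matrix.det_succ_row _ (Fin.last (n + 1)), Fin.sum_univ_castSucc, Fin.sum_univ_castSucc]
    have hz : ∀ j : Fin n, pathMatrix w (n + 2) (Fin.last (n + 1)) j.castSucc.castSucc = 0 := by
      intro j
      have := j.2
      simp only [pathMatrix, Fin.ext_iff, Fin.val_last, Fin.val_castSucc]
      rw [if_neg (by omega), if_neg (by omega), sub_zero]
    have hl : pathMatrix w (n + 2) (Fin.last (n + 1)) (Fin.last (n + 1)) = w (n + 1) := by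
      simp [pathMatrix]
    have hm : pathMatrix w (n + 2) (Fin.last (n + 1)) (Fin.last n).castSucc = -1 := by
      simp [pathMatrix, Fin.ext_iff]
    have hs : (pathMatrix w (n + 2)).submatrix (Fin.last (n + 1)).succAbove
        (Fin.last (n + 1)).succAbove = pathMatrix w (n + 1) := by
      ext i j
      simp [pathMatrix, Fin.ext_iff]
    -- The last column of this minor has the single nonzero entry `-1`, in its last row.
    have hminor : ((pathMatrix w (n + 2)).submatrix (Fin.last (n + 1)).succAbove
        (Fin.last n).castSucc.succAbove).det = -(pathMatrix w n).det := by
      rw [Matrix.det_succ_column _ (Fin.last n), Fin.sum_univ_castSucc]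
      have hv : ∀ i : Fin n, ((pathMatrix w (n + 2)).submatrix (Fin.last (n + 1)).succAbove
          (Fin.last n).castSucc.succAbove) i.castSucc (Fin.last n) = 0 := by
        intro i
        have := i.2
        simp only [pathMatrix, Matrix.submatrix_apply, Fin.succAbove_last,
          Fin.succAbove_castSucc_self, Fin.ext_iff, Fin.val_castSucc, Fin.val_succ, Fin.val_last]
        rw [if_neg (by omega), if_neg (by omega), sub_zero]
      have hw : ((pathMatrix w (n + 2)).submatrix (Fin.last (n + 1)).succAbove
          (Fin.last n).castSucc.succAbove) (Fin.last n) (Fin.last n) = -1 := by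
        simp [pathMatrix, Fin.ext_iff]
      have hx : ((pathMatrix w (n + 2)).submatrix (Fin.last (n + 1)).succAbove
          (Fin.last n).castSucc.succAbove).submatrix (Fin.last n).succAbove
          (Fin.last n).succAbove = pathMatrix w n := by
        ext i j
        have : (Fin.last n).castSucc.succAbove j.castSucc = j.castSucc.castSucc := by
          rw [Fin.succAbove_of_castSucc_lt]
          simp [Fin.lt_def]
        simp [pathMatrix, Fin.ext_iff, this]
      simp only [hv, hw, hx]
      simp [← two_mul]
    simp only [hz, hl, hm, hs, hminor, h1, h0, continuant]
    have e1 : ((-1 : ℤ)) ^ (n + 1 + n) = -1 := Odd.neg_one_pow ⟨n, by ring⟩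
    have e2 : ((-1 : ℤ)) ^ (n + 1 + (n + 1)) = 1 := Even.neg_one_pow ⟨n + 1, rfl⟩
    simp [e1, e2]
    ring

theorem continuant_lt_succ {w : ℕ → ℤ} {m : ℕ} (hw : ∀ i < m, 2 ≤ w i) :
    ∀ n < m, 0 < continuant w n ∧ continuant w n < continuant w (n + 1)
  | 0, h => by
    have := hw 0 h
    simp only [continuant]
    omega
  | n + 1, h => by
    obtain ⟨h1, h2⟩ := continuant_lt_succ hw n (by omega)
    have := hw (n + 1) h
    refine ⟨by omega, ?_⟩
    rw [continuant]
    nlinarith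

/-- Two consecutive continuants determine the word, by the negative continued fraction
expansion of their ratio. -/
theorem continuant_pair_injective {w w' : ℕ → ℤ} : ∀ n : ℕ,
    (∀ i < n + 1, 2 ≤ w i) → (∀ i < n + 1, 2 ≤ w' i) →
    continuant w (n + 1) = continuant w' (n + 1) → continuant w n = continuant w' n →
    ∀ i < n + 1, w i = w' i
  | 0, _, _, h, _ => by
    intro i hi
    obtain rfl : i = 0 := by omega
    simpa [continuant] using h
  | n + 1, hw, hw', h, h0 => by
    obtain ⟨a1, a2⟩ := continuant_lt_succ hw n (by omega)
    obtain ⟨b1, b2⟩ := continuant_lt_succ hw' n (by omega)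
    rw [continuant, continuant, ← h0] at h
    rw [← h0] at b2
    -- Both subtracted continuants lie strictly between 0 and the common `K_{n+1}`, so they differ
    -- by less than `K_{n+1}`, while unequal letters would shift the product by at least that much.
    have hlast : w (n + 1) = w' (n + 1) := by
      rcases lt_trichotomy (w (n + 1)) (w' (n + 1)) with hlt | heq | hlt
      · nlinarith
      · exact heq
      · nlinarith
    rw [hlast] at h
    have ih := continuant_pair_injective n (fun i hi => hw i (by omega))
      (fun i hi => hw' i (by omega)) h0 (by linarith)
    intro i hi
    rcases Nat.lt_succ_iff_lt_or_eq.1 hi with hi | rfl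
    · exact ih i hi
    · exact hlast

end TreeSpectrum

/-! ### Twin blocks, and the structure of the word graph -/

namespace TreeSpectrum

/-- If two families of rows of `M` have the same diagonal block `J`, do not interact and agree in
all other columns, then `det J` divides `det M`. -/
theorem det_dvd_det_of_twins {R n ι : Type*} [CommRing R] [Fintype n] [DecidableEq n]
    [Fintype ι] [DecidableEq ι] {M : Matrix ι ι R} {J : Matrix n n R} {α β : n → ι}
    (hinj : Function.Injective (Sum.elim α β))
    (h11 : ∀ i j, M (α i) (α j) = J i j) (h22 : ∀ i j, M (β i) (β j) = J i j)
    (h12 : ∀ i j, M (α i) (β j) = 0) (h21 : ∀ i j, M (β i) (α j) = 0)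
    (hrest : ∀ i x, (∀ j, x ≠ α j) → (∀ j, x ≠ β j) → M (α i) x = M (β i) x) :
    J.det ∣ M.det := by
  classical
  let k := {x : ι // (∀ j, x ≠ α j) ∧ ∀ j, x ≠ β j}
  let g : n ⊕ (n ⊕ k) → ι := Sum.elim α (Sum.elim β Subtype.val)
  have hg : Function.Bijective g := by
    constructor
    · rintro (i | i | i) (j | j | j) h
      · exact congrArg Sum.inl (Sum.inl_injective (hinj (a₁ := Sum.inl i) (a₂ := Sum.inl j) h))
      · exact absurd (hinj (a₁ := Sum.inl i) (a₂ := Sum.inr j) h) (by simp)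
      · exact absurd h.symm (j.2.1 i)
      · exact absurd (hinj (a₁ := Sum.inr i) (a₂ := Sum.inl j) h) (by simp)
      · exact congrArg (Sum.inr ∘ Sum.inl)
          (Sum.inr_injective (hinj (a₁ := Sum.inr i) (a₂ := Sum.inr j) h))
      · exact absurd h.symm (j.2.2 i)
      · exact absurd h (i.2.1 j)
      · exact absurd h (i.2.2 j)
      · exact congrArg (Sum.inr ∘ Sum.inr) (Subtype.ext h)
    · intro x
      by_cases h1 : ∃ j, x = α j
      · exact ⟨Sum.inl h1.choose, h1.choose_spec.symm⟩
      by_cases h2 : ∃ j, x = β j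
      · exact ⟨Sum.inr (Sum.inl h2.choose), h2.choose_spec.symm⟩
      push Not at h1 h2
      exact ⟨Sum.inr (Sum.inr ⟨x, h1, h2⟩), rfl⟩
  let e := Equiv.ofBijective g hg
  let M' := M.submatrix e e
  -- Subtracting the `β` rows from the `α` rows leaves `(J, -J, 0)`. `A` undoes this operation and
  -- `B` carries the common factor `J`.
  let A : Matrix (n ⊕ (n ⊕ k)) (n ⊕ (n ⊕ k)) R :=
    Matrix.fromBlocks 1 (Matrix.fromCols 1 0) 0 1
  let B : Matrix (n ⊕ (n ⊕ k)) (n ⊕ (n ⊕ k)) R := Matrix.fromBlocks J 0 0 1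
  let C : Matrix (n ⊕ (n ⊕ k)) (n ⊕ (n ⊕ k)) R :=
    Matrix.fromBlocks 1 (Matrix.fromCols (-1) 0) M'.toBlocks₂₁ M'.toBlocks₂₂
  have hM : M' = A * (B * C) := by
    simp only [A, B, C, Matrix.fromBlocks_multiply]
    ext (i | i) (j | j | j)
    · simp [M', e, g, h11, Matrix.mul_apply, Matrix.toBlocks₂₁, h21, Matrix.fromCols]
    · simp [M', e, g, h12, Matrix.mul_apply, Matrix.toBlocks₂₂, h22, Matrix.fromCols,
        Matrix.one_apply]
    · simp [M', e, g, hrest _ j.1 j.2.1 j.2.2, Matrix.mul_apply, Matrix.toBlocks₂₂,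
        Matrix.fromCols, Matrix.one_apply]
    all_goals simp [Matrix.toBlocks₂₁, Matrix.toBlocks₂₂]
  have hdet : M.det = M'.det := (Matrix.det_submatrix_equiv_self e M).symm
  rw [hdet, hM, Matrix.det_mul, Matrix.det_mul]
  simp only [A, B, Matrix.det_fromBlocks_zero₂₁, Matrix.det_one, one_mul, mul_one]
  exact dvd_mul_right _ _

theorem pathDegree_le_two (n : ℕ) (i : Fin n) : pathDegree n i ≤ 2 := by
  unfold pathDegree
  split_ifs <;> omega

theorem one_le_pathDegree {n : ℕ} (hn : 2 ≤ n) (i : Fin n) : 1 ≤ pathDegree n i := by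
  unfold pathDegree
  split_ifs <;> omega

theorem card_path_neighbors {n : ℕ} (i : Fin n) :
    (Finset.univ.filter fun j : Fin n => i.val + 1 = j.val ∨ j.val + 1 = i.val).card =
      pathDegree n i := by
  classical
  rw [Finset.filter_or, Finset.card_union_of_disjoint, pathDegree, add_comm]
  · congr 1
    · split_ifs with h
      · rw [Finset.card_eq_one]
        refine ⟨⟨i.val - 1, by omega⟩, ?_⟩
        ext j
        simp only [Finset.mem_filter, Finset.mem_univ, true_and, Finset.mem_singleton,
          Fin.ext_iff]
        omega
      · rw [Finset.card_eq_zero, Finset.filter_eq_empty_iff]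
        intro j _
        omega
    · split_ifs with h
      · rw [Finset.card_eq_one]
        refine ⟨⟨i.val + 1, h⟩, ?_⟩
        ext j
        simp only [Finset.mem_filter, Finset.mem_univ, true_and, Finset.mem_singleton,
          Fin.ext_iff]
        omega
      · rw [Finset.card_eq_zero, Finset.filter_eq_empty_iff]
        intro j _
        omega
  · rw [Finset.disjoint_filter]
    intro j _ h
    omega

theorem degree_eq_add_pathDegree {V : Type*} [Fintype V] {G : SimpleGraph V}
    [DecidableRel G.Adj] {n q h : ℕ} {p : Fin n → V} {a : Fin q → V}
    (hp : Function.Injective p) (ha : Function.Injective a) (hpa : ∀ i t, p i ≠ a t)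
    (hh : h ≤ q) (i : Fin n)
    (hadj : ∀ x, G.Adj (p i) x ↔ (∃ t, t.val < h ∧ a t = x) ∨
      ∃ j, (i.val + 1 = j.val ∨ j.val + 1 = i.val) ∧ p j = x) :
    G.degree (p i) = h + pathDegree n i := by
  classical
  have : G.neighborFinset (p i) = (Finset.univ.filter fun t : Fin q => t.val < h).image a ∪
      (Finset.univ.filter fun j : Fin n => i.val + 1 = j.val ∨ j.val + 1 = i.val).image p := by
    ext x
    simp [hadj]
  rw [SimpleGraph.degree, this, Finset.card_union_of_disjoint, Finset.card_image_of_injective _ ha,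
    Finset.card_image_of_injective _ hp, card_path_neighbors, Fin.card_filter_val_lt,
    min_eq_right hh]
  rw [Finset.disjoint_left]
  intro x h1 h2
  obtain ⟨t, _, rfl⟩ := Finset.mem_image.1 h1
  obtain ⟨j, _, hj⟩ := Finset.mem_image.1 h2
  exact hpa _ _ hj

/-- The word `w` read as a sequence of integers. -/
def letters {m : ℕ} (w : Fin m → ℕ) (i : ℕ) : ℤ :=
  if h : i < m then w ⟨i, h⟩ else 0

theorem reducedLaplacian_apply {V : Type*} [Fintype V] [DecidableEq V] (G : SimpleGraph V)
    [DecidableRel G.Adj] (r : V) (x y : {v : V // v ≠ r}) :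
    reducedLaplacian G r x y =
      (if x = y then (G.degree x : ℤ) else 0) - if G.Adj x y then 1 else 0 := by
  simp [reducedLaplacian, SimpleGraph.lapMatrix, SimpleGraph.degMatrix, Matrix.diagonal_apply,
    SimpleGraph.adjMatrix_apply, Subtype.ext_iff]

section WordGraph

variable {m q : ℕ} {w : Fin m → ℕ}

theorem mem_words : w ∈ words m q ↔ ∀ i, 2 ≤ w i ∧ w i ≤ q + 1 := by
  simp [words]

open Classical in
theorem degree_long (hm : 3 ≤ m) (hw : w ∈ words m q) (c : Bool) (i : Fin m) :
    (wordGraph m q w).degree (.long c i) = w i := by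
  have h := mem_words.1 hw i
  have h2 := pathDegree_le_two m i
  have h1 := one_le_pathDegree (by omega) i
  rw [degree_eq_add_pathDegree (p := Vertex.long c) (a := Vertex.anchor) (h := longAnchors w i)
    (fun _ _ h => by simpa using h) (fun _ _ h => by simpa using h) (by simp)
    (by unfold longAnchors; omega)]
  · unfold longAnchors; omega
  · rintro (_ | t | ⟨d, j⟩ | ⟨d, j⟩)
    · simp [wordGraph, Link]
    · simp [wordGraph, Link]
    · simp only [wordGraph, Link, SimpleGraph.fromRel_adj, Vertex.long.injEq, ne_eq]
      grind
    · simp [wordGraph, Link]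

open Classical in
theorem degree_short (hm : 3 ≤ m) (hw : w ∈ words m q) (c : Bool) (i : Fin (m - 1)) :
    (wordGraph m q w).degree (.short c i) = w (Fin.castLE (Nat.sub_le m 1) i) := by
  have h := mem_words.1 hw (Fin.castLE (Nat.sub_le m 1) i)
  have h2 := pathDegree_le_two (m - 1) i
  have h1 := one_le_pathDegree (by omega) i
  rw [degree_eq_add_pathDegree (p := Vertex.short c) (a := Vertex.anchor)
    (h := shortAnchors w i)
    (fun _ _ h => by simpa using h) (fun _ _ h => by simpa using h) (by simp)
    (by unfold shortAnchors; omega)]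
  · unfold shortAnchors; omega
  · rintro (_ | t | ⟨d, j⟩ | ⟨d, j⟩)
    · simp [wordGraph, Link]
    · simp [wordGraph, Link]
    · simp [wordGraph, Link]
    · simp only [wordGraph, Link, SimpleGraph.fromRel_adj, Vertex.short.injEq, ne_eq]
      grind

theorem continuant_dvd_spanningTreeCount (hm : 3 ≤ m) (hw : w ∈ words m q) :
    continuant (letters w) m ∣ (spanningTreeCount (wordGraph m q w) : ℤ) := by
  classical
  rw [spanningTreeCount_eq_det _ Vertex.root, ← det_pathMatrix]
  have hdiag : ∀ c, ∀ i j : Fin m, reducedLaplacian (wordGraph m q w) Vertex.root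
      ⟨.long c i, by simp⟩ ⟨.long c j, by simp⟩ = pathMatrix (letters w) m i j := by
    intro c i j
    rw [reducedLaplacian_apply, pathMatrix, degree_long hm hw]
    congr 1
    · simp [letters]
    · simp only [wordGraph, Link, SimpleGraph.fromRel_adj, ne_eq, Vertex.long.injEq]
      grind
  have hcross : ∀ c, ∀ i j : Fin m, reducedLaplacian (wordGraph m q w) Vertex.root
      ⟨.long c i, by simp⟩ ⟨.long (!c) j, by simp⟩ = 0 := by
    intro c i j
    rw [reducedLaplacian_apply]
    simp [wordGraph, Link]
  refine det_dvd_det_of_twins (α := fun i => ⟨.long false i, by simp⟩)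
    (β := fun i => ⟨.long true i, by simp⟩) ?_ (hdiag false) (hdiag true) (hcross false)
    (hcross true) ?_
  · rintro (i | i) (j | j) h <;> simp_all
  · rintro i ⟨_ | t | ⟨_ | _, j⟩ | ⟨d, j⟩, hx⟩ h1 h2
    · exact absurd rfl hx
    · rw [reducedLaplacian_apply, reducedLaplacian_apply]
      simp [wordGraph, Link]
    · exact absurd rfl (h1 j)
    · exact absurd rfl (h2 j)
    · rw [reducedLaplacian_apply, reducedLaplacian_apply]
      simp [wordGraph, Link]

/-- The short twins carry the first `m - 1` letters. Their anchor counts use the degrees of the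
shorter path, so the last vertex also has degree equal to its letter. -/
theorem continuant_pred_dvd_spanningTreeCount (hm : 3 ≤ m) (hw : w ∈ words m q) :
    continuant (letters w) (m - 1) ∣ (spanningTreeCount (wordGraph m q w) : ℤ) := by
  classical
  rw [spanningTreeCount_eq_det _ Vertex.root, ← det_pathMatrix]
  have hdiag : ∀ c, ∀ i j : Fin (m - 1), reducedLaplacian (wordGraph m q w) Vertex.root
      ⟨.short c i, by simp⟩ ⟨.short c j, by simp⟩ = pathMatrix (letters w) (m - 1) i j := by
    intro c i j
    rw [reducedLaplacian_apply, pathMatrix, degree_short hm hw]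
    congr 1
    · have : i.val < m := by omega
      simp [letters, this, Fin.castLE]
    · simp only [wordGraph, Link, SimpleGraph.fromRel_adj, ne_eq, Vertex.short.injEq]
      grind
  have hcross : ∀ c, ∀ i j : Fin (m - 1), reducedLaplacian (wordGraph m q w) Vertex.root
      ⟨.short c i, by simp⟩ ⟨.short (!c) j, by simp⟩ = 0 := by
    intro c i j
    rw [reducedLaplacian_apply]
    simp [wordGraph, Link]
  refine det_dvd_det_of_twins (α := fun i => ⟨.short false i, by simp⟩)
    (β := fun i => ⟨.short true i, by simp⟩) ?_ (hdiag false) (hdiag true) (hcross false)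
    (hcross true) ?_
  · rintro (i | i) (j | j) h <;> simp_all
  · rintro i ⟨_ | t | ⟨d, j⟩ | ⟨_ | _, j⟩, hx⟩ h1 h2
    · exact absurd rfl hx
    · rw [reducedLaplacian_apply, reducedLaplacian_apply]
      simp [wordGraph, Link]
    · rw [reducedLaplacian_apply, reducedLaplacian_apply]
      simp [wordGraph, Link]
    · exact absurd rfl (h1 j)
    · exact absurd rfl (h2 j)

/-- The first vertex of each path has path degree 1 and letter at least 2, so it is joined to the
first anchor. Connectedness makes `τ` nonzero, as divisor counting requires. -/
theorem wordGraph_connected (hm : 3 ≤ m) (hq : 1 ≤ q) (hw : w ∈ words m q) :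
    (wordGraph m q w).Connected := by
  have hanchor : ∀ t, (wordGraph m q w).Reachable .root (.anchor t) := fun t =>
    SimpleGraph.Adj.reachable (by simp [wordGraph, Link])
  have hlong : ∀ c, ∀ i (hi : i < m), (wordGraph m q w).Reachable .root (.long c ⟨i, hi⟩) := by
    intro c i
    induction i with
    | zero =>
      intro hi
      refine (hanchor ⟨0, hq⟩).trans (SimpleGraph.Adj.reachable ?_)
      have := mem_words.1 hw ⟨0, hi⟩
      have h : 0 < longAnchors w ⟨0, hi⟩ := by
        simp only [longAnchors, pathDegree]
        split_ifs <;> omega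
      simp [wordGraph, Link, h]
    | succ i ih =>
      intro hi
      refine (ih (by omega)).trans (SimpleGraph.Adj.reachable ?_)
      simp [wordGraph, Link]
  have hshort : ∀ c, ∀ i (hi : i < m - 1),
      (wordGraph m q w).Reachable .root (.short c ⟨i, hi⟩) := by
    intro c i
    induction i with
    | zero =>
      intro hi
      refine (hanchor ⟨0, hq⟩).trans (SimpleGraph.Adj.reachable ?_)
      have := mem_words.1 hw (Fin.castLE (Nat.sub_le m 1) ⟨0, hi⟩)
      have h : 0 < shortAnchors w ⟨0, hi⟩ := by
        simp only [shortAnchors, pathDegree]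
        split_ifs <;> omega
      simp [wordGraph, Link, h]
    | succ i ih =>
      intro hi
      refine (ih (by omega)).trans (SimpleGraph.Adj.reachable ?_)
      simp [wordGraph, Link]
  have key : ∀ v, (wordGraph m q w).Reachable .root v := by
    rintro (_ | t | ⟨c, i⟩ | ⟨c, i⟩)
    · exact SimpleGraph.Reachable.refl _
    · exact hanchor t
    · exact hlong c i.1 i.2
    · exact hshort c i.1 i.2
  have : Nonempty (Vertex m q) := ⟨.root⟩
  exact ⟨fun a b => (key a).symm.trans (key b)⟩

theorem card_vertex (hm : 1 ≤ m) : Nat.card (Vertex m q) = vertexCount m q := by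
  let e : Vertex m q ≃ Unit ⊕ Fin q ⊕ (Bool × Fin m) ⊕ (Bool × Fin (m - 1)) :=
    { toFun := fun
        | .root => .inl ()
        | .anchor t => .inr (.inl t)
        | .long c i => .inr (.inr (.inl (c, i)))
        | .short c i => .inr (.inr (.inr (c, i)))
      invFun := fun
        | .inl _ => .root
        | .inr (.inl t) => .anchor t
        | .inr (.inr (.inl x)) => .long x.1 x.2
        | .inr (.inr (.inr x)) => .short x.1 x.2
      left_inv := by rintro (_ | _ | _ | _) <;> rfl
      right_inv := by rintro (_ | _ | _ | _) <;> rfl }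
  rw [Nat.card_congr e, Nat.card_eq_fintype_card]
  simp [vertexCount]
  omega

theorem card_words : (words m q).card = q ^ m := by
  simp [words]

/-- At most `d(n) ^ 2` words have `n` spanning trees. -/
theorem card_fiber_le (hm : 3 ≤ m) (n : ℕ) (hn : n ≠ 0) :
    ((words m q).filter fun w => spanningTreeCount (wordGraph m q w) = n).card ≤
      n.divisors.card ^ 2 := by
  rw [sq, ← Finset.card_product]
  have h2 : ∀ w ∈ words m q, ∀ i < m, 2 ≤ letters w i := by
    intro w hw i hi
    have := (mem_words.1 hw ⟨i, hi⟩).1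
    simp only [letters, hi, dite_true]
    exact_mod_cast this
  have hpos : ∀ w ∈ words m q,
      0 < continuant (letters w) (m - 1) ∧ 0 < continuant (letters w) m := by
    intro w hw
    have := continuant_lt_succ (h2 w hw) (m - 1) (by omega)
    rw [Nat.sub_add_cancel (by omega)] at this
    omega
  -- Both continuants are positive, so passing to `natAbs` loses nothing.
  refine Finset.card_le_card_of_injOn (fun w =>
    ((continuant (letters w) m).natAbs, (continuant (letters w) (m - 1)).natAbs)) ?_ ?_
  · intro w hmem
    obtain ⟨hw, rfl⟩ := Finset.mem_filter.1 hmem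
    simp only [Finset.coe_product, Set.mem_prod, Finset.mem_coe, Nat.mem_divisors]
    exact ⟨⟨Int.natAbs_dvd_natAbs.2 (continuant_dvd_spanningTreeCount hm hw), hn⟩,
      Int.natAbs_dvd_natAbs.2 (continuant_pred_dvd_spanningTreeCount hm hw), hn⟩
  · intro w hw w' hw' h
    have hw := (Finset.mem_filter.1 hw).1
    have hw' := (Finset.mem_filter.1 hw').1
    have := hpos w hw
    have := hpos w' hw'
    simp only [Prod.mk.injEq] at h
    have e1 : continuant (letters w) m = continuant (letters w') m := by omega
    have e0 : continuant (letters w) (m - 1) = continuant (letters w') (m - 1) := by omega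
    obtain ⟨k, rfl⟩ : ∃ k, m = k + 1 := ⟨m - 1, by omega⟩
    have := continuant_pair_injective k (h2 w hw) (h2 w' hw') e1 e0
    funext i
    have hi := this i i.2
    simp only [letters, i.2, dite_true] at hi
    exact_mod_cast hi

end WordGraph

end TreeSpectrum

/-! ### Counting words by fibers -/

open TreeSpectrum in
theorem proposition5p1 (η : ℝ) (hη : 0 < η) :
    ∃ s₀ : ℕ, ∀ m q : ℕ, 3 ≤ m → 1 ≤ q → s₀ ≤ m + q →
      (q : ℝ) ^ m /
          (((q : ℝ) + 1) ^ (2 * η * (m : ℝ)) *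
            (TreeSpectrum.vertexCount m q : ℝ) ^ (η * (TreeSpectrum.vertexCount m q : ℝ))) ≤
        (((TreeSpectrum.words m q).image
          fun w => TreeSpectrum.spanningTreeCount (TreeSpectrum.wordGraph m q w)).card : ℝ) := by
  -- With exponent `η / 4`, squaring the divisor bound at `n ≤ N^N` gives `C^2 N^(ηN/2)`. The other
  -- half of the exponent absorbs `C^2`: the choice of `s₀` forces `C^2 ≤ N` and `1 ≤ ηN/2`.
  obtain ⟨C, hC1, hC⟩ := exists_card_divisors_le_rpow (ε := η / 4) (by positivity)
  obtain ⟨s₀, hs₀⟩ := exists_nat_ge (max (C ^ 2) (2 / η))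
  refine ⟨s₀, fun m q hm hq hs => ?_⟩
  have hNs : s₀ ≤ vertexCount m q := by unfold vertexCount; omega
  have hN1 : 1 ≤ vertexCount m q := by unfold vertexCount; omega
  have hcard : Nat.card (Vertex m q) = vertexCount m q := card_vertex (by omega)
  have hbound : ∀ w, spanningTreeCount (wordGraph m q w) ≤ vertexCount m q ^ vertexCount m q := by
    intro w
    have : Nonempty (Vertex m q) := ⟨.root⟩
    simpa only [hcard] using spanningTreeCount_le (wordGraph m q w)
  set N := vertexCount m q
  have hN1' : (1 : ℝ) ≤ N := by exact_mod_cast hN1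
  have hNs' : (s₀ : ℝ) ≤ N := by exact_mod_cast hNs
  have hNC : C ^ 2 ≤ N := (le_max_left _ _).trans (hs₀.trans hNs')
  have hNη : 1 ≤ η * N / 2 := by
    have : 2 / η ≤ N := (le_max_right _ _).trans (hs₀.trans hNs')
    rw [div_le_iff₀ hη] at this
    linarith
  have hC2 : C ^ 2 ≤ (N : ℝ) ^ (η * N / 2) :=
    hNC.trans (Real.self_le_rpow_of_one_le hN1' hNη)
  have hfiber : ∀ n ∈ (words m q).image fun w => spanningTreeCount (wordGraph m q w),
      (((words m q).filter fun w => spanningTreeCount (wordGraph m q w) = n).card : ℝ) ≤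
        (N : ℝ) ^ (η * N) := by
    intro n hn
    obtain ⟨w, hw, rfl⟩ := Finset.mem_image.1 hn
    have hne := (spanningTreeCount_pos (wordGraph_connected hm hq hw)).ne'
    have hle : (spanningTreeCount (wordGraph m q w) : ℝ) ≤ (N : ℝ) ^ (N : ℝ) := by
      rw [Real.rpow_natCast]
      exact_mod_cast hbound w
    calc _ ≤ ((spanningTreeCount (wordGraph m q w)).divisors.card : ℝ) ^ 2 := by
          exact_mod_cast card_fiber_le hm _ hne
      _ ≤ (C * ((N : ℝ) ^ (N : ℝ)) ^ (η / 4)) ^ 2 := by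
          refine pow_le_pow_left₀ (Nat.cast_nonneg _) ((hC _ hne).trans ?_) 2
          gcongr
      _ = C ^ 2 * (N : ℝ) ^ (η * N / 2) := by
          rw [mul_pow, ← Real.rpow_mul (by positivity), ← Real.rpow_mul_natCast (by positivity)]
          congr 2
          push_cast
          ring
      _ ≤ (N : ℝ) ^ (η * N / 2) * (N : ℝ) ^ (η * N / 2) := by gcongr
      _ = (N : ℝ) ^ (η * N) := by
          rw [← Real.rpow_add (by positivity), add_halves]
  -- The fiber bound alone gives the estimate; this factor is at least 1 and only weakens it.
  have hq1 : (1 : ℝ) ≤ ((q : ℝ) + 1) ^ (2 * η * (m : ℝ)) :=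
    Real.one_le_rpow (by linarith [(Nat.cast_nonneg q : (0 : ℝ) ≤ q)]) (by positivity)
  rw [div_le_iff₀ (by positivity)]
  calc (q : ℝ) ^ m = ((words m q).card : ℝ) := by rw [card_words]; push_cast; rfl
    _ = ∑ n ∈ (words m q).image fun w => spanningTreeCount (wordGraph m q w),
          (((words m q).filter fun w => spanningTreeCount (wordGraph m q w) = n).card : ℝ) := by
        rw [Finset.card_eq_sum_card_image fun w => spanningTreeCount (wordGraph m q w)]
        push_cast
        rfl
    _ ≤ _ := (Finset.sum_le_card_nsmul _ _ _ hfiber)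
    _ ≤ _ := by
        rw [nsmul_eq_mul]
        gcongr
        exact le_mul_of_one_le_left (by positivity) hq1
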